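/- All digraphs are finite. An oriented graph is a digraph without loops and without directed cycles of length two. A digraph $D$ is $H$-free if it has no induced subdigraph isomorphic to $H$. The clique number $\omega(D)$ is the maximum size of a clique in the underlying undirected graph of $D$, and the dichromatic number $\vec\chi(D)$ is the minimum number of colors in a coloring of the vertices of $D$ without monochromatic directed cycles. A digraph $H$ is called $\vec\chi$-bounding if there is a function $f$ such that $\vec\chi(D)\le f(\omega(D))$ for every $H$-free oriented graph $D$. Let $P_4$ be the path on four vertices; up to isomorphism its orientations are $\vec P_4$: $\rightarrow\rightarrow\rightarrow$, $\vec A_4$: $\leftarrow\rightarrow\leftarrow$, $\vec Q_4$: $\rightarrow\leftarrow\leftarrow$ and $\vec Q_4'$: $\leftarrow\leftarrow\rightarrow$. **Theorem.** Every orientation $H$ of $P_4$ is $\vec\chi$-bounding. More precisely, for every oriented graph $D$: 1. if $D$ is $\vec Q_4$-free or $\vec Q_4'$-free, then $\vec\chi(D)\le(\omega(D)+3)^{\omega(D)+4.5}$; 2. if $D$ is $\vec P_4$-free, then $\vec\chi(D)\le(\omega(D)+6)^{\omega(D)+7.5}$; 3. if $D$ is $\vec A_4$-free, then $\vec\chi(D)\le(\omega(D)+7)^{\omega(D)+8.5}$.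 In particular, for every orientation $H$ of $P_4$, every $H$-free oriented graph $D$ satisfies $\vec\chi(D)\le(\omega(D)+7)^{\omega(D)+8.5}$. Consequently, for every orientation $H$ of $P_4$ and every integer $k\ge 0$ there is a constant $C$ such that every $H$-free oriented graph $D$ that does not contain the transitive tournament on $k$ vertices satisfies $\vec\chi(D)\le C$. -/

import Mathlib

universe u

namespace Digraph

/-- A digraph is oriented if it has no digon and no loop: the two ordered pairs `(v, w)` and
`(w, v)` are never both arcs. (For `v = w` this says that there is no loop.) -/
def IsOriented {V : Type*} (D : Digraph V) : Prop :=
  ∀ v w, D.Adj v w → ¬ D.Adj w v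

/-- `D` contains `H` as an induced subdigraph: there is an injection of the vertices of `H` into
the vertices of `D` that preserves both arcs and non-arcs. -/
def Contains {V W : Type*} (D : Digraph V) (H : Digraph W) : Prop :=
  Nonempty (H.Adj ↪r D.Adj)

/-- `D` is `H`-free: it does not contain `H` as an induced subdigraph. -/
def IsFree {V W : Type*} (D : Digraph V) (H : Digraph W) : Prop :=
  ¬ D.Contains H

/-- The clique number `ω(D)`: the clique number of the underlying undirected graph. -/
noncomputable def cliqueNumber {V : Type*} (D : Digraph V) : ℕ :=
  D.toSimpleGraphInclusive.cliqueNum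

/-- `p 0 → p 1 → ⋯ → p n → p 0` is a directed cycle of `D` on `n + 1` distinct vertices
(addition in `Fin (n + 1)` wraps around). -/
def IsDirectedCycle {V : Type*} (D : Digraph V) {n : ℕ} (p : Fin (n + 1) → V) : Prop :=
  Function.Injective p ∧ ∀ i, D.Adj (p i) (p (i + 1))

/-- A vertex colouring is a dicolouring if no directed cycle is monochromatic, that is, if each
colour class induces an acyclic digraph. -/
def IsDicolouring {V C : Type*} (D : Digraph V) (c : V → C) : Prop :=
  ∀ (n : ℕ) (p : Fin (n + 1) → V), D.IsDirectedCycle p → ∃ i j, c (p i) ≠ c (p j)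

/-- `D` has a dicolouring with (at most) `k` colours. -/
def Dicolourable {V : Type*} (D : Digraph V) (k : ℕ) : Prop :=
  ∃ c : V → Fin k, D.IsDicolouring c

/-- The dichromatic number: the minimum number of colours of a dicolouring. -/
noncomputable def dichromaticNumber {V : Type*} (D : Digraph V) : ℕ :=
  sInf {k | D.Dicolourable k}

/-- A finite oriented graph has a dicolouring, so the minimum that defines its dichromatic
number is attained. -/
theorem IsOriented.dicolourable_dichromaticNumber {V : Type*} [Finite V] {D : Digraph V}
    (hD : D.IsOriented) : D.Dicolourable D.dichromaticNumber := by
  refine Nat.sInf_mem (s := {k | D.Dicolourable k}) ?_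
  obtain ⟨k, ⟨e⟩⟩ := Finite.exists_equiv_fin V
  refine ⟨k, e, fun n p hp => ?_⟩
  refine ⟨0, 0 + 1, fun h => ?_⟩
  have h1 := hp.2 0
  rw [← e.injective h] at h1
  exact hD _ _ h1 h1

/-- `H` is an orientation of the simple graph `G`: it is oriented and its underlying undirected
graph is `G`. -/
def IsOrientationOf {V : Type*} (H : Digraph V) (G : SimpleGraph V) : Prop :=
  H.IsOriented ∧ H.toSimpleGraphInclusive = G

/-- A class of finite digraphs is `χ⃗`-bounded if the dichromatic number of its members is bounded
by a function of the clique number. -/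
def IsDichiBounded (𝒟 : ∀ V : Type u, Digraph V → Prop) : Prop :=
  ∃ f : ℕ → ℕ, ∀ (V : Type u) [Finite V] (D : Digraph V), 𝒟 V D →
    D.dichromaticNumber ≤ f D.cliqueNumber

/-- `H` is `χ⃗`-bounding if the class of (finite) `H`-free oriented graphs is `χ⃗`-bounded. -/
def IsDichiBounding {W : Type*} (H : Digraph W) : Prop :=
  IsDichiBounded.{u} fun _ D => D.IsOriented ∧ D.IsFree H

/-- The directed path `0 → 1 → 2 → 3`. -/
def P4 : Digraph (Fin 4) where
  Adj i j := (i, j) ∈ ({(0, 1), (1, 2), (2, 3)} : Finset (Fin 4 × Fin 4))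

/-- The oriented path `0 ← 1 → 2 ← 3`. -/
def A4 : Digraph (Fin 4) where
  Adj i j := (i, j) ∈ ({(1, 0), (1, 2), (3, 2)} : Finset (Fin 4 × Fin 4))

/-- The oriented path `0 → 1 ← 2 ← 3`. -/
def Q4 : Digraph (Fin 4) where
  Adj i j := (i, j) ∈ ({(0, 1), (2, 1), (3, 2)} : Finset (Fin 4 × Fin 4))

/-- The oriented path `0 ← 1 ← 2 → 3`. -/
def Q4' : Digraph (Fin 4) where
  Adj i j := (i, j) ∈ ({(1, 0), (2, 1), (2, 3)} : Finset (Fin 4 × Fin 4))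

/-- The transitive tournament on `k` vertices. -/
def transitiveTournament (k : ℕ) : Digraph (Fin k) where
  Adj i j := i < j

end Digraph

section

open Relation

variable {V : Type u}

/-! The proof gives `2 ^ ω` for the two orientations `Q4`, `Q4'`, `5 ^ ω` for `P4` and `6 ^ ω` for
`A4`; the stated bounds are weaker. By induction on the clique size every neighbourhood has a
colouring with `γ` colours, and strong components can be coloured separately, so it suffices to
colour a strongly connected set with `c * γ` colours (`dicolOn_pow_of_strong`).

For this, a set `X` is grown from a root until it covers everything, while the vertices adjacent to
`X` are kept coloured. For `Q4`, one out-neighbour is added at a time: freeness forbids arcs from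
vertices still not adjacent to `X` into the newly adjacent ones, so old and new colourings glue
without new colours.

For `P4` and `A4`, a shortest ear is added at a time. A new vertex is judged by its first and last
neighbours on the ear. If either is joined to it in the favourable direction, that neighbour, its
predecessor or successor on the ear, the vertex and an arc from or to a non-neighbour would form the
forbidden path. This gives two classes costing `γ` each, besides `γ` for the root
(`Grown.exists_classes`). The remaining bad vertices cost `3 * γ` for `A4`, by minimality of the
ear, and `2 * γ` for `P4`, where ears with at most three inner vertices suffice
(`P4Free.exists_grown`). -/

theorem Relation.TransGen.of_imp {r p : V → V → Prop} {a b : V} (h : TransGen r a b)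
    (hrp : ∀ x y, r x y → p x y) : TransGen p a b := TransGen.lift id hrp _ _ h

theorem Relation.ReflTransGen.of_imp {r p : V → V → Prop} {a b : V} (h : ReflTransGen r a b)
    (hrp : ∀ x y, r x y → p x y) : ReflTransGen p a b := ReflTransGen.lift id hrp _ _ h

/-! ### Colourings without monochromatic closed walks. -/

/-- `u` and `v` are joined by an arc in one of the two directions. -/
def Adjacent (R : V → V → Prop) (u v : V) : Prop := R u v ∨ R v u

/-- The vertices that are adjacent to some vertex of `X`. -/
def Nbhd (R : V → V → Prop) (X : Set V) : Set V := {v | ∃ x ∈ X, Adjacent R x v}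

/-- The relation `R` restricted to the set `S`. -/
def Restr (R : V → V → Prop) (S : Set V) (u v : V) : Prop := R u v ∧ u ∈ S ∧ v ∈ S

/-- The set `S` has a colouring with `k` colours whose classes contain no closed `R`-walk. -/
def DicolOn (R : V → V → Prop) (S : Set V) (k : ℕ) : Prop :=
  ∃ c : V → ℕ, (∀ v ∈ S, c v < k) ∧
    ∀ v, ¬ TransGen (fun x y => R x y ∧ x ∈ S ∧ y ∈ S ∧ c x = c y) v v

theorem Adjacent.symm {R : V → V → Prop} {u v : V} (h : Adjacent R u v) : Adjacent R v u :=
  Or.symm h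

theorem Nbhd.mono {R : V → V → Prop} {X Y : Set V} (h : X ⊆ Y) : Nbhd R X ⊆ Nbhd R Y :=
  fun _ ⟨x, hx, hxv⟩ => ⟨x, h hx, hxv⟩

theorem mem_nbhd_singleton {R : V → V → Prop} {x v : V} (h : Adjacent R x v) :
    v ∈ Nbhd R {x} := ⟨x, rfl, h⟩

theorem not_adjacent_of_notMem_nbhd {R : V → V → Prop} {X : Set V} {x v : V}
    (hv : v ∉ Nbhd R X) (hx : x ∈ X) : ¬ Adjacent R x v := fun h => hv ⟨x, hx, h⟩

namespace DicolOn

variable {R : V → V → Prop} {S T : Set V} {k l : ℕ}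

theorem mono (h : DicolOn R S k) (hT : T ⊆ S) (hkl : k ≤ l) : DicolOn R T l := by
  obtain ⟨c, hc, ha⟩ := h
  refine ⟨c, fun v hv => (hc v (hT hv)).trans_le hkl, fun v hv => ha v ?_⟩
  exact hv.of_imp fun x y h => ⟨h.1, hT h.2.1, hT h.2.2.1, h.2.2.2⟩

theorem subset (h : DicolOn R S k) (hT : T ⊆ S) : DicolOn R T k := h.mono hT le_rfl

theorem of_empty (h : ∀ v, v ∉ S) : DicolOn R S k := by
  refine ⟨fun _ => 0, fun v hv => absurd hv (h v), fun v hv => ?_⟩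
  obtain ⟨_, h', _⟩ := TransGen.head'_iff.1 hv
  exact h v h'.2.1

/-- If a quantity never increases along arcs, then colourings of its level sets combine. -/
theorem of_antitone {α : Type*} [PartialOrder α] (f : V → α)
    (hf : ∀ u ∈ S, ∀ v ∈ S, R u v → f v ≤ f u)
    (h : ∀ a, DicolOn R {v | v ∈ S ∧ f v = a} k) : DicolOn R S k := by
  choose c hc ha using h
  refine ⟨fun v => c (f v) v, fun v hv => hc (f v) v ⟨hv, rfl⟩, fun v hv => ?_⟩
  -- Along a walk `f` only decreases, so a closed walk has constant `f` and stays in one level set.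
  have key : ∀ y, TransGen (fun x y => R x y ∧ x ∈ S ∧ y ∈ S ∧ c (f x) x = c (f y) y) v y →
      f y ≤ f v ∧ (f y = f v → TransGen (fun x y => R x y ∧ x ∈ {z | z ∈ S ∧ f z = f v} ∧
        y ∈ {z | z ∈ S ∧ f z = f v} ∧ c (f v) x = c (f v) y) v y) := by
    intro y hy
    induction hy with
    | single hy =>
      refine ⟨hf _ hy.2.1 _ hy.2.2.1 hy.1, fun e => TransGen.single ?_⟩
      refine ⟨hy.1, ⟨hy.2.1, rfl⟩, ⟨hy.2.2.1, e⟩, ?_⟩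
      rw [hy.2.2.2, e]
    | @tail b d _ hy ih =>
      have h1 := hf _ hy.2.1 _ hy.2.2.1 hy.1
      refine ⟨h1.trans ih.1, fun e => ?_⟩
      have eb : f b = f v := le_antisymm ih.1 (e ▸ h1)
      refine (ih.2 eb).tail ⟨hy.1, ⟨hy.2.1, eb⟩, ⟨hy.2.2.1, e⟩, ?_⟩
      rw [← eb, hy.2.2.2, e, eb]
  exact ha _ v ((key v hv).2 rfl)

/-- A closed walk cannot leave `S` and return when no arc leads from `S` to `T`, so both colourings
may share the same `k` colours. -/
theorem glue (hS : DicolOn R S k) (hT : DicolOn R T k)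
    (h : ∀ u ∈ S, ∀ v ∈ T, ¬ R u v) : DicolOn R (S ∪ T) k := by
  classical
  refine of_antitone (fun v => if v ∈ S then 0 else 1) ?_ fun a => ?_
  · intro u hu v hv huv
    by_cases h1 : u ∈ S
    · by_cases h2 : v ∈ S
      · simp [h1, h2]
      · exact absurd huv (h u h1 v (hv.resolve_left h2))
    · simp only [h1, if_false]; split_ifs <;> omega
  · by_cases ha : a = 0
    · refine hS.subset ?_
      rintro v ⟨hv, hva⟩
      by_contra hvS
      simp [hvS] at hva
      omega
    · refine hT.subset ?_
      rintro v ⟨hv, hva⟩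
      refine hv.resolve_left fun hvS => ?_
      simp [hvS] at hva
      omega

theorem union (hS : DicolOn R S k) (hT : DicolOn R T l) : DicolOn R (S ∪ T) (k + l) := by
  classical
  obtain ⟨c, hc, ha⟩ := hS
  obtain ⟨d, hd, hb⟩ := hT
  have hT' : ∀ v ∈ S ∪ T, v ∉ S → v ∈ T := fun v hv h => hv.resolve_left h
  refine ⟨fun v => if v ∈ S then c v else k + d v, fun v hv => ?_, fun v hv => ?_⟩
  · by_cases h : v ∈ S
    · simp only [h, if_true]; have := hc v h; omega
    · simp only [h, if_false]; have := hd v (hT' v hv h); omega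
  · have side : ∀ x y, (R x y ∧ x ∈ S ∪ T ∧ y ∈ S ∪ T ∧
        (if x ∈ S then c x else k + d x) = (if y ∈ S then c y else k + d y)) →
        ((x ∈ S ∧ y ∈ S ∧ R x y ∧ x ∈ S ∧ y ∈ S ∧ c x = c y) ∨
          (x ∉ S ∧ y ∉ S ∧ R x y ∧ x ∈ T ∧ y ∈ T ∧ d x = d y)) := by
      rintro x y ⟨hxy, hx, hy, e⟩
      by_cases h1 : x ∈ S <;> by_cases h2 : y ∈ S <;> simp only [h1, h2, if_true, if_false] at e
      · exact Or.inl ⟨h1, h2, hxy, h1, h2, e⟩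
      · have := hc x h1; omega
      · have := hc y h2; omega
      · exact Or.inr ⟨h1, h2, hxy, hT' x hx h1, hT' y hy h2, by omega⟩
    by_cases hvS : v ∈ S
    · refine ha v (?_ : TransGen _ v v ∧ v ∈ S).1
      have key : ∀ y, TransGen (fun x y => R x y ∧ x ∈ S ∪ T ∧ y ∈ S ∪ T ∧
          (if x ∈ S then c x else k + d x) = (if y ∈ S then c y else k + d y)) v y →
          TransGen (fun x y => R x y ∧ x ∈ S ∧ y ∈ S ∧ c x = c y) v y ∧ y ∈ S := by
        intro y hy
        induction hy with
        | single h =>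
          rcases side _ _ h with h' | h'
          · exact ⟨TransGen.single h'.2.2, h'.2.1⟩
          · exact absurd hvS h'.1
        | tail _ h ih =>
          rcases side _ _ h with h' | h'
          · exact ⟨ih.1.tail h'.2.2, h'.2.1⟩
          · exact absurd ih.2 h'.1
      exact key v hv
    · refine hb v (?_ : TransGen _ v v ∧ v ∉ S).1
      have key : ∀ y, TransGen (fun x y => R x y ∧ x ∈ S ∪ T ∧ y ∈ S ∪ T ∧
          (if x ∈ S then c x else k + d x) = (if y ∈ S then c y else k + d y)) v y →
          TransGen (fun x y => R x y ∧ x ∈ T ∧ y ∈ T ∧ d x = d y) v y ∧ y ∉ S := by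
        intro y hy
        induction hy with
        | single h =>
          rcases side _ _ h with h' | h'
          · exact absurd h'.1 hvS
          · exact ⟨TransGen.single h'.2.2, h'.2.1⟩
        | tail _ h ih =>
          rcases side _ _ h with h' | h'
          · exact absurd h'.1 ih.2
          · exact ⟨ih.1.tail h'.2.2, h'.2.1⟩
      exact key v hv

/-- Vertices that lie on no arc need no attention. -/
theorem of_support (hk : 0 < k) (h : DicolOn R T k)
    (hT : ∀ u ∈ S, ∀ v ∈ S, R u v → u ∈ T ∧ v ∈ T) : DicolOn R S k := by
  classical
  obtain ⟨c, hc, ha⟩ := h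
  refine ⟨fun v => if v ∈ T then c v else 0, fun v _ => ?_, fun v hv => ha v ?_⟩
  · by_cases h : v ∈ T
    · simpa only [h, if_true] using hc v h
    · simpa only [h, if_false] using hk
  · refine hv.of_imp fun x y h => ?_
    obtain ⟨h1, h2⟩ := hT x h.2.1 y h.2.2.1 h.1
    exact ⟨h.1, h1, h2, by simpa only [h1, h2, if_true] using h.2.2.2⟩

theorem of_restr (h : DicolOn (Restr R S) S k) : DicolOn R S k := by
  obtain ⟨c, hc, ha⟩ := h
  refine ⟨c, hc, fun v hv => ha v ?_⟩
  exact hv.of_imp fun x y h => ⟨⟨h.1, h.2.1, h.2.2.1⟩, h.2⟩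

theorem restr (h : DicolOn R S k) : DicolOn (Restr R T) S k := by
  obtain ⟨c, hc, ha⟩ := h
  refine ⟨c, hc, fun v hv => ha v ?_⟩
  exact hv.of_imp fun x y h => ⟨h.1.1, h.2⟩

theorem of_swap (h : DicolOn (Function.swap R) S k) : DicolOn R S k := by
  obtain ⟨c, hc, ha⟩ := h
  refine ⟨c, hc, fun v hv => ha v ?_⟩
  rw [← transGen_swap] at hv
  exact hv.of_imp fun x y h => ⟨h.1, h.2.2.1, h.2.1, h.2.2.2.symm⟩

end DicolOn

/-! ### Reduction to strongly connected sets. -/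

/-- No arc has its reverse as an arc. -/
def Oriented (R : V → V → Prop) : Prop := ∀ u v, R u v → ¬ R v u

/-- Every set of pairwise adjacent vertices has at most `n` elements. -/
def CliqueLE (R : V → V → Prop) (n : ℕ) : Prop :=
  ∀ s : Finset V, (∀ u ∈ s, ∀ v ∈ s, u ≠ v → Adjacent R u v) → s.card ≤ n

/-- All arcs lie in `S` and `S` is strongly connected. -/
structure StrongOn (R : V → V → Prop) (S : Set V) : Prop where
  supported : ∀ u v, R u v → u ∈ S ∧ v ∈ S
  reach : ∀ u ∈ S, ∀ v ∈ S, ReflTransGen R u v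

theorem Oriented.restr {R : V → V → Prop} (h : Oriented R) (S : Set V) : Oriented (Restr R S) :=
  fun u v huv hvu => h u v huv.1 hvu.1

theorem Oriented.ne {R : V → V → Prop} (h : Oriented R) {u v : V} (huv : Adjacent R u v) :
    u ≠ v := by
  rintro rfl
  rcases huv with h1 | h1 <;> exact h _ _ h1 h1

theorem CliqueLE.restr_nbhd {R : V → V → Prop} {n : ℕ} (hO : Oriented R)
    (h : CliqueLE R (n + 2)) (v : V) : CliqueLE (Restr R (Nbhd R {v})) (n + 1) := by
  classical
  intro s hs
  by_contra! hcard
  have hsub : ∀ u ∈ s, Adjacent R v u := by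
    intro u hu
    -- Vertices outside the neighbourhood are isolated in the restriction, hence cliques only of
    -- size one; a clique with two vertices lies in the neighbourhood and can be enlarged by `v`.
    obtain ⟨w, hw, huw⟩ := Finset.exists_mem_ne (show 1 < s.card by omega) u
    obtain ⟨x, rfl, hx⟩ : u ∈ Nbhd R {v} := by
      rcases hs u hu w hw huw.symm with h1 | h1
      · exact h1.2.1
      · exact h1.2.2
    exact hx
  have hv : v ∉ s := fun hv => hO.ne (hsub v hv) rfl
  have := h (insert v s) ?_
  · rw [Finset.card_insert_of_notMem hv] at this
    omega
  · intro a ha b hb hab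
    rcases Finset.mem_insert.1 ha with rfl | ha'
    · rcases Finset.mem_insert.1 hb with rfl | hb'
      · exact absurd rfl hab
      · exact hsub b hb'
    · rcases Finset.mem_insert.1 hb with rfl | hb'
      · exact (hsub a ha').symm
      · exact (hs a ha' b hb' hab).imp (fun h => h.1) (fun h => h.1)

/-- Equal reachable sets mean mutual reachability, so these fibres are the strong components; a walk
between two vertices of a fibre never leaves it. -/
theorem strongOn_restr_fibre {R : V → V → Prop} (s : Set V) :
    StrongOn (Restr R {v | {w | ReflTransGen R v w} = s})
      {v | {w | ReflTransGen R v w} = s} where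
  supported _ _ h := h.2
  reach := by
    intro u hu v hv
    have huv : ReflTransGen R u v := by
      have : v ∈ {w | ReflTransGen R v w} := ReflTransGen.refl
      rw [Set.mem_ofPred_eq] at hu hv
      rw [hv, ← hu] at this
      exact this
    induction huv using ReflTransGen.head_induction_on with
    | refl => exact ReflTransGen.refl
    | @head a b hab hbv ih =>
      have hb : {w | ReflTransGen R b w} = s := by
        rw [Set.mem_ofPred_eq] at hu hv
        apply le_antisymm
        · rw [← hu]
          exact fun w hw => ReflTransGen.head hab hw
        · rw [← hv]
          exact fun w hw => hbv.trans hw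
      exact ReflTransGen.head ⟨hab, hu, hb⟩ (ih hb)

/-- If, in a hereditary class, a bound `γ` on neighbourhoods yields the bound `c * γ` for strongly
connected members, then `c ^ n` colours suffice when all cliques have at most `n + 1`
vertices. -/
theorem dicolOn_pow_of_strong {c : ℕ} (hc : 0 < c) (Free : (V → V → Prop) → Prop)
    (hrestr : ∀ R S, Free R → Free (Restr R S))
    (step : ∀ R S γ, 0 < γ → Oriented R → Free R → StrongOn R S → S.Nonempty →
      (∀ v, DicolOn R (Nbhd R {v}) γ) → DicolOn R S (c * γ)) (n : ℕ) :
    ∀ R, Oriented R → Free R → CliqueLE R (n + 1) → DicolOn R Set.univ (c ^ n) := by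
  classical
  induction n with
  | zero =>
    intro R hO _ hR
    refine ⟨fun _ => 0, fun v _ => by simp, fun v hv => ?_⟩
    obtain ⟨w, hvw, _⟩ := TransGen.head'_iff.1 hv
    have := hR {v, w} (by
      intro a ha b hb hab
      simp only [Finset.mem_insert, Finset.mem_singleton] at ha hb
      rcases ha with rfl | rfl <;> rcases hb with rfl | rfl
      · exact absurd rfl hab
      · exact Or.inl hvw.1
      · exact Or.inr hvw.1
      · exact absurd rfl hab)
    rw [Finset.card_pair (hO.ne (Or.inl hvw.1))] at this
    omega
  | succ n ih =>
    intro R hO hF hR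
    have hN : ∀ v, DicolOn R (Nbhd R {v}) (c ^ n) := fun v =>
      DicolOn.of_restr ((ih _ (hO.restr _) (hrestr _ _ hF)
        (hR.restr_nbhd hO v)).subset (Set.subset_univ _))
    -- The reachable set can only shrink along an arc, so the strong components are coloured
    -- independently.
    refine DicolOn.of_antitone (fun v => {w | ReflTransGen R v w})
      (fun u _ v _ huv w hw => ReflTransGen.head huv hw) fun s => ?_
    refine DicolOn.subset (S := {v | {w | ReflTransGen R v w} = s}) ?_ fun v hv => hv.2
    rcases Set.eq_empty_or_nonempty {v | {w | ReflTransGen R v w} = s} with he | he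
    · exact DicolOn.of_empty fun v hv => Set.notMem_empty v (he ▸ hv)
    · refine DicolOn.of_restr ?_
      rw [pow_succ, mul_comm]
      refine step _ _ _ (pow_pos hc n) (hO.restr _) (hrestr _ _ hF) (strongOn_restr_fibre s) he ?_
      intro v
      refine (hN v).restr.subset ?_
      rintro w ⟨x, hx, hxw⟩
      exact ⟨x, hx, hxw.imp (fun h => h.1) fun h => h.1⟩

/-! ### The three forbidden paths and their restrictions. -/

/-- No induced `a → b ← c ← d`. -/
def Q4Free (R : V → V → Prop) : Prop := ∀ a b c d, R a b → R c b → R d c →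
  ¬ Adjacent R a c → ¬ Adjacent R a d → ¬ Adjacent R b d → False

/-- No induced `a → b → c → d`. -/
def P4Free (R : V → V → Prop) : Prop := ∀ a b c d, R a b → R b c → R c d →
  ¬ Adjacent R a c → ¬ Adjacent R a d → ¬ Adjacent R b d → False

/-- No induced `a ← b → c ← d`. -/
def A4Free (R : V → V → Prop) : Prop := ∀ a b c d, R b a → R b c → R d c →
  ¬ Adjacent R a c → ¬ Adjacent R a d → ¬ Adjacent R b d → False

theorem not_adjacent_of_restr {R : V → V → Prop} {S : Set V} {u v : V} (hu : u ∈ S) (hv : v ∈ S)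
    (h : ¬ Adjacent (Restr R S) u v) : ¬ Adjacent R u v :=
  fun h' => h (h'.imp (fun h => ⟨h, hu, hv⟩) fun h => ⟨h, hv, hu⟩)

theorem Q4Free.restr {R : V → V → Prop} (h : Q4Free R) (S : Set V) : Q4Free (Restr R S) :=
  fun a b c d hab hcb hdc hac had hbd => h a b c d hab.1 hcb.1 hdc.1
    (not_adjacent_of_restr hab.2.1 hcb.2.1 hac) (not_adjacent_of_restr hab.2.1 hdc.2.1 had)
    (not_adjacent_of_restr hab.2.2 hdc.2.1 hbd)

theorem P4Free.restr {R : V → V → Prop} (h : P4Free R) (S : Set V) : P4Free (Restr R S) :=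
  fun a b c d hab hbc hcd hac had hbd => h a b c d hab.1 hbc.1 hcd.1
    (not_adjacent_of_restr hab.2.1 hbc.2.2 hac) (not_adjacent_of_restr hab.2.1 hcd.2.2 had)
    (not_adjacent_of_restr hab.2.2 hcd.2.2 hbd)

theorem A4Free.restr {R : V → V → Prop} (h : A4Free R) (S : Set V) : A4Free (Restr R S) :=
  fun a b c d hba hbc hdc hac had hbd => h a b c d hba.1 hbc.1 hdc.1
    (not_adjacent_of_restr hba.2.2 hbc.2.2 hac) (not_adjacent_of_restr hba.2.2 hdc.2.1 had)
    (not_adjacent_of_restr hba.2.1 hdc.2.1 hbd)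

/-- An arc leaves every proper nonempty subset of a strongly connected set. -/
theorem StrongOn.exists_arc_out {R : V → V → Prop} {S X : Set V} (hS : StrongOn R S) {r y : V}
    (hr : r ∈ X) (hrS : r ∈ S) (hy : y ∈ S) (hyX : y ∉ X) : ∃ q ∈ X, ∃ p ∉ X, R q p := by
  by_contra! h
  refine hyX ?_
  have := hS.reach r hrS y hy
  clear hyX hy
  induction this with
  | refl => exact hr
  | tail _ hbc ih => by_contra hc; exact h _ ih _ hc hbc

/-- The bound on a `Nbhd` of a set is a bound on the set itself when every arc lies in it. -/
theorem DicolOn.of_nbhd {R : V → V → Prop} {S : Set V} {k : ℕ} (hk : 0 < k)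
    (h : DicolOn R (Nbhd R S) k) : DicolOn R S k :=
  h.of_support hk fun u hu v hv huv => ⟨⟨v, hv, Or.inr huv⟩, ⟨u, hu, Or.inl huv⟩⟩

/-! ### The case `Q4`: growth by single vertices. -/

/-- Grow a set from a root by adding vertices that have an in-neighbour in the set; the vertices
away from the root are coloured according to their first neighbour. -/
theorem Q4Free.dicolOn_strong [Finite V] {R : V → V → Prop} {S : Set V} {γ : ℕ}
    (hF : Q4Free R) (hγ : 0 < γ) (hS : StrongOn R S) (hne : S.Nonempty)
    (hN : ∀ v, DicolOn R (Nbhd R {v}) γ) : DicolOn R S (2 * γ) := by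
  obtain ⟨r, hr⟩ := hne
  let P : Set V → Prop := fun X => r ∈ X ∧ ∃ M, M ⊆ Nbhd R X ∧ Nbhd R X ⊆ Nbhd R {r} ∪ M ∧
    (∀ v ∈ M, ∀ u, u ∉ Nbhd R X → ¬ R u v) ∧ DicolOn R M γ
  have h0 : P {r} := ⟨rfl, ∅, Set.empty_subset _, Set.subset_union_left,
    fun v hv => absurd hv (Set.notMem_empty v), DicolOn.of_empty (Set.notMem_empty)⟩
  obtain ⟨X, _, hX⟩ := Finite.exists_le_maximal h0
  obtain ⟨hrX, M, hMX, hXM, hM, hMγ⟩ := hX.prop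
  have hSX : S ⊆ X := by
    intro y hy
    by_contra hyX
    obtain ⟨q, hq, p, hp, hqp⟩ := hS.exists_arc_out hrX hr hy hyX
    have hsub : X ⊆ X ∪ {p} := Set.subset_union_left
    have hnb : ∀ v, v ∈ Nbhd R (X ∪ {p}) → v ∉ Nbhd R X → Adjacent R p v := by
      rintro v ⟨x, hx | rfl, hxv⟩ hv
      · exact absurd ⟨x, hx, hxv⟩ hv
      · exact hxv
    have key : P (X ∪ {p}) := by
      refine ⟨hsub hrX, M ∪ {v | v ∈ Nbhd R (X ∪ {p}) ∧ v ∉ Nbhd R X},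
        Set.union_subset (hMX.trans (Nbhd.mono hsub)) fun v hv => hv.1, ?_, ?_, ?_⟩
      · intro v hv
        by_cases h : v ∈ Nbhd R X
        · rcases hXM h with h | h
          · exact Or.inl h
          · exact Or.inr (Or.inl h)
        · exact Or.inr (Or.inr ⟨hv, h⟩)
      · rintro v (hv | ⟨hv, hvX⟩) u hu huv
        · exact hM v hv u (fun h => hu (Nbhd.mono hsub h)) huv
        -- Here `q → p` and `u → v` are arcs and `v` is adjacent to `p`; whichever way that last arc
        -- points, the four vertices induce the forbidden path.
        · have hup : ¬ Adjacent R p u := not_adjacent_of_notMem_nbhd hu (Or.inr rfl)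
          have huq : ¬ Adjacent R q u := not_adjacent_of_notMem_nbhd hu (Or.inl hq)
          have hvq : ¬ Adjacent R q v := not_adjacent_of_notMem_nbhd hvX hq
          rcases hnb v hv hvX with h | h
          · exact hF u v p q huv h hqp (fun h => hup h.symm) (fun h => huq h.symm)
              (fun h => hvq h.symm)
          · exact hF q p v u hqp h huv hvq huq hup
      -- The new vertices are all adjacent to `p` and send no arc into `M`, since they were not
      -- adjacent to `X`; hence `γ` colours still suffice.
      · rw [Set.union_comm]
        exact ((hN p).subset fun v hv => ⟨p, rfl, hnb v hv.1 hv.2⟩).glue hMγ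
          fun u hu v hv => hM v hv u hu.2
    exact hp (hX.le_of_ge key hsub (Or.inr rfl))
  have := ((hN r).union hMγ).subset hXM
  rw [two_mul]
  refine (this.subset (Nbhd.mono hSX)).of_nbhd (by omega)

/-! ### Shortest ears. -/

/-- `v` ends an `R`-walk with `n + 1` arcs that starts in `X` and then stays outside `X`. -/
def OutLevel (R : V → V → Prop) (X : Set V) : ℕ → V → Prop
  | 0, v => v ∉ X ∧ ∃ x ∈ X, R x v
  | n + 1, v => v ∉ X ∧ ∃ u, OutLevel R X n u ∧ R u v

/-- `v` starts an `R`-walk with `n + 1` arcs that ends in `X` and is outside `X` before. -/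
def InLevel (R : V → V → Prop) (X : Set V) : ℕ → V → Prop
  | 0, v => v ∉ X ∧ ∃ x ∈ X, R v x
  | n + 1, v => v ∉ X ∧ ∃ u, InLevel R X n u ∧ R v u

section Levels
variable {R : V → V → Prop} {X : Set V} {m n : ℕ} {v : V}

theorem OutLevel.notMem (h : OutLevel R X n v) : v ∉ X := by
  cases n <;> exact h.1

theorem InLevel.notMem (h : InLevel R X n v) : v ∉ X := by
  cases n <;> exact h.1

theorem OutLevel.exists_add (h : OutLevel R X m v) (h' : InLevel R X n v) :
    ∃ w, OutLevel R X (m + n) w ∧ InLevel R X 0 w := by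
  induction n generalizing m v with
  | zero => exact ⟨v, h, h'⟩
  | succ n ih =>
    obtain ⟨_, w, hw, hvw⟩ := h'
    obtain ⟨z, hz⟩ := ih (m := m + 1) ⟨hw.notMem, v, h, hvw⟩ hw
    exact ⟨z, by rwa [show m + (n + 1) = m + 1 + n by omega]⟩

/-- `X → w 0 → ⋯ → w m → X` is a directed walk that leaves `X`, with `m` least possible. -/
structure IsShortestEar (R : V → V → Prop) (X : Set V) (m : ℕ) (w : ℕ → V) : Prop where
  out : ∀ i ≤ m, OutLevel R X i (w i)
  arc : ∀ i < m, R (w i) (w (i + 1))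
  last : InLevel R X 0 (w m)
  min : ∀ i v, OutLevel R X i v → InLevel R X 0 v → m ≤ i

theorem OutLevel.exists_walk (h : OutLevel R X n v) : ∃ w : ℕ → V, w n = v ∧
    (∀ i ≤ n, OutLevel R X i (w i)) ∧ ∀ i < n, R (w i) (w (i + 1)) := by
  induction n generalizing v with
  | zero =>
    refine ⟨fun _ => v, rfl, fun i hi => ?_, fun i hi => absurd hi (Nat.not_lt_zero i)⟩
    obtain rfl : i = 0 := by omega
    exact h
  | succ n ih =>
    obtain ⟨hv, u, hu, huv⟩ := id h
    obtain ⟨w, hw, h1, h2⟩ := ih hu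
    refine ⟨fun i => if i ≤ n then w i else v, by simp, fun i hi => ?_, fun i hi => ?_⟩
    · by_cases hin : i ≤ n
      · simp only [hin, if_true]; exact h1 i hin
      · obtain rfl : i = n + 1 := by omega
        simpa using h
    · by_cases hin : i + 1 ≤ n
      · simp only [hin, show i ≤ n by omega, if_true]; exact h2 i hin
      · obtain rfl : i = n := by omega
        simpa [hw] using huv

theorem exists_isShortestEar (h : ∃ n v, OutLevel R X n v ∧ InLevel R X 0 v) :
    ∃ m w, IsShortestEar R X m w := by
  classical
  obtain ⟨v, hv, hv'⟩ := Nat.find_spec h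
  obtain ⟨w, hw, h1, h2⟩ := hv.exists_walk
  exact ⟨Nat.find h, w, h1, h2, hw ▸ hv', fun i v hi hi' => Nat.find_min' h ⟨v, hi, hi'⟩⟩

namespace IsShortestEar
variable {w : ℕ → V}

theorem inLevel (h : IsShortestEar R X m w) {i : ℕ} (hi : i ≤ m) : InLevel R X (m - i) (w i) := by
  induction hk : m - i generalizing i with
  | zero =>
    obtain rfl : i = m := by omega
    exact h.last
  | succ k ih =>
    exact ⟨(h.out i hi).notMem, _, ih (i := i + 1) (by omega) (by omega), h.arc i (by omega)⟩

/-- The walk from `X` to `v` followed by the walk back to `X` contains an ear. Every exclusion of a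
shortcut past a shortest ear is an instance of this inequality. -/
theorem le_add (h : IsShortestEar R X m w) {i j : ℕ} (hi : OutLevel R X i v)
    (hj : InLevel R X j v) : m ≤ i + j := by
  obtain ⟨z, hz, hz'⟩ := hi.exists_add hj
  exact h.min _ z hz hz'

theorem exists_pred (h : IsShortestEar R X m w) {i : ℕ} (hi : i ≤ m) :
    ∃ p, R p (w i) ∧ (p ∈ X ∨ ∃ k < i, p = w k) := by
  cases i with
  | zero => obtain ⟨_, x, hx, hxw⟩ := h.out 0 hi; exact ⟨x, hxw, Or.inl hx⟩
  | succ i => exact ⟨w i, h.arc i (by omega), Or.inr ⟨i, by omega, rfl⟩⟩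

theorem exists_succ (h : IsShortestEar R X m w) {i : ℕ} (hi : i ≤ m) :
    ∃ p, R (w i) p ∧ (p ∈ X ∨ ∃ k, i < k ∧ k ≤ m ∧ p = w k) := by
  rcases hi.eq_or_lt with rfl | hi
  · obtain ⟨_, x, hx, hxw⟩ := h.last; exact ⟨x, hxw, Or.inl hx⟩
  · exact ⟨w (i + 1), h.arc i hi, Or.inr ⟨i + 1, by omega, by omega, rfl⟩⟩

end IsShortestEar
end Levels

/-- Some arc leaves `X`, and a walk from its head back to the root has a first return to `X`. -/
theorem StrongOn.exists_isShortestEar {R : V → V → Prop} {S X : Set V} (hS : StrongOn R S)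
    {r y : V} (hr : r ∈ X) (hrS : r ∈ S) (hy : y ∈ S) (hyX : y ∉ X) :
    ∃ m w, IsShortestEar R X m w := by
  refine _root_.exists_isShortestEar ?_
  obtain ⟨q, hq, p, hp, hqp⟩ := hS.exists_arc_out hr hrS hy hyX
  have key : ∀ z, ReflTransGen R z r → ∀ n, OutLevel R X n z →
      ∃ n v, OutLevel R X n v ∧ InLevel R X 0 v := by
    intro z hz
    induction hz using ReflTransGen.head_induction_on with
    | refl => exact fun n h => absurd hr h.notMem
    | @head a b hab _ ih =>
      intro n hn
      by_cases hb : b ∈ X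
      · exact ⟨n, a, hn, hn.notMem, b, hb, hab⟩
      · exact ih (n + 1) ⟨hb, a, hn, hab⟩
  exact key p (hS.reach p (hS.supported q p hqp).2 r hrS) 0 ⟨hp, q, hq, hqp⟩

/-! ### Sets grown by ears. -/

/-- The sets obtained from `{r}` by repeatedly adding a shortest ear of admissible length. -/
inductive Grown (R : V → V → Prop) (adm : ℕ → Prop) (r : V) : Set V → Prop
  | root : Grown R adm r {r}
  | ear {X : Set V} {m : ℕ} {w : ℕ → V} (hX : Grown R adm r X) (hw : IsShortestEar R X m w)
      (hm : adm m) : Grown R adm r (X ∪ {v | ∃ i ≤ m, v = w i})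

section Grown
variable {R : V → V → Prop} {adm : ℕ → Prop} {r : V} {X : Set V}

theorem Grown.root_mem (h : Grown R adm r X) : r ∈ X := by
  induction h with
  | root => rfl
  | ear _ _ _ ih => exact Or.inl ih

theorem Grown.subset {S : Set V} (h : Grown R adm r X) (hS : StrongOn R S) (hr : r ∈ S) :
    X ⊆ S := by
  induction h with
  | root => rintro _ rfl; exact hr
  | ear _ hw _ ih =>
    refine Set.union_subset ih ?_
    rintro _ ⟨i, hi, rfl⟩
    obtain ⟨p, hp, _⟩ := hw.exists_pred hi
    exact (hS.supported _ _ hp).2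

theorem Restr.subset {X Y : Set V} (h : X ⊆ Y) {u v : V} (huv : Restr R X u v) :
    Restr R Y u v := ⟨huv.1, h huv.2.1, h huv.2.2⟩

/-- Each ear starts and ends at the earlier set, so a grown set is strongly connected by walks
inside itself. This lets a property that passes along its arcs spread to the whole set. -/
theorem Grown.reach_root (h : Grown R adm r X) : ∀ v ∈ X,
    ReflTransGen (Restr R X) r v ∧ ReflTransGen (Restr R X) v r := by
  induction h with
  | root => rintro _ rfl; exact ⟨ReflTransGen.refl, ReflTransGen.refl⟩
  | @ear X m w hX hw _ ih =>
    have hsub : X ⊆ X ∪ {v | ∃ i ≤ m, v = w i} := Set.subset_union_left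
    have hmem : ∀ i ≤ m, w i ∈ X ∪ {v | ∃ i ≤ m, v = w i} := fun i hi => Or.inr ⟨i, hi, rfl⟩
    have hup : ∀ v ∈ X, ReflTransGen (Restr R (X ∪ {v | ∃ i ≤ m, v = w i})) r v ∧
        ReflTransGen (Restr R (X ∪ {v | ∃ i ≤ m, v = w i})) v r := fun v hv =>
      ⟨(ih v hv).1.of_imp fun _ _ h => h.subset hsub, (ih v hv).2.of_imp fun _ _ h => h.subset hsub⟩
    rintro v (hv | ⟨i, hi, rfl⟩)
    · exact hup v hv
    · constructor
      · induction i with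
        | zero =>
          obtain ⟨_, x, hx, hxw⟩ := hw.out 0 hi
          exact (hup x hx).1.tail ⟨hxw, hsub hx, hmem 0 hi⟩
        | succ i ih =>
          exact (ih (by omega)).tail ⟨hw.arc i hi, hmem i (by omega), hmem _ hi⟩
      · induction hk : m - i generalizing i with
        | zero =>
          obtain rfl : i = m := by omega
          obtain ⟨_, x, hx, hxw⟩ := hw.last
          exact (hup x hx).2.head ⟨hxw, hmem _ hi, hsub hx⟩
        | succ k ih =>
          exact (ih (i + 1) (by omega) (by omega)).head
            ⟨hw.arc i (by omega), hmem i hi, hmem _ (by omega)⟩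

theorem Grown.forall_of_pred_closed (h : Grown R adm r X) {Z : V → Prop} {x : V} (hx : x ∈ X)
    (hZ : Z x) (hcl : ∀ a ∈ X, ∀ b ∈ X, R a b → Z b → Z a) : ∀ y ∈ X, Z y := by
  intro y hy
  have := (h.reach_root y hy).2.trans (h.reach_root x hx).1
  clear hy
  induction this using ReflTransGen.head_induction_on with
  | refl => exact hZ
  | head hab _ ih => exact hcl _ hab.2.1 _ hab.2.2 hab.1 ih

theorem Grown.forall_of_succ_closed (h : Grown R adm r X) {Z : V → Prop} {x : V} (hx : x ∈ X)
    (hZ : Z x) (hcl : ∀ a ∈ X, ∀ b ∈ X, R a b → Z a → Z b) : ∀ y ∈ X, Z y := by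
  intro y hy
  have := (h.reach_root x hx).2.trans (h.reach_root y hy).1
  clear hy
  induction this with
  | refl => exact hZ
  | tail _ hab ih => exact hcl _ hab.2.1 _ hab.2.2 hab.1 ih

end Grown

/-! ### Colouring the neighbourhood of a grown set. -/

/-- The vertices, not adjacent to `X`, whose first and last neighbours on the ear `w 0, …, w m`
differ and are joined to them in the direction that needs special care. -/
def BadOnEar (R τ : V → V → Prop) (X : Set V) (m : ℕ) (w : ℕ → V) : Set V :=
  {v | v ∉ Nbhd R X ∧ ∃ f l, f < l ∧ l ≤ m ∧ τ v (w f) ∧ τ (w l) v ∧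
    (∀ k < f, ¬ Adjacent R (w k) v) ∧ ∀ k, l < k → k ≤ m → ¬ Adjacent R (w k) v}

/-- Every vertex adjacent to a grown set is adjacent to the root or lies in one of three classes:
no arc leads from the first class to a vertex not adjacent to the set, no arc leads from such a
vertex to the second class, and the vertices in the third class have both an in-neighbour and an
out-neighbour in the set. -/
theorem Grown.exists_classes {R τ : V → V → Prop} {adm : ℕ → Prop} {r : V} {X : Set V} {γ k : ℕ}
    (hX : Grown R adm r X) (hτ : τ = R ∨ τ = Function.swap R)
    (hout : ∀ p q u v, R p q → τ q u → R u v → ¬ Adjacent R p u → ¬ Adjacent R p v →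
      ¬ Adjacent R q v → False)
    (hin : ∀ u v p q, R u v → τ v p → R p q → ¬ Adjacent R u p → ¬ Adjacent R u q →
      ¬ Adjacent R v q → False)
    (hN : ∀ v, DicolOn R (Nbhd R {v}) γ)
    (hbad : ∀ X m w, IsShortestEar R X m w → adm m → DicolOn R (BadOnEar R τ X m w) k) :
    ∃ M₁ M₂ M₃, M₁ ⊆ Nbhd R X ∧ M₂ ⊆ Nbhd R X ∧ M₃ ⊆ Nbhd R X ∧
      Nbhd R X ⊆ Nbhd R {r} ∪ (M₁ ∪ M₂ ∪ M₃) ∧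
      (∀ u ∈ M₁, ∀ v, v ∉ Nbhd R X → ¬ R u v) ∧ (∀ v ∈ M₂, ∀ u, u ∉ Nbhd R X → ¬ R u v) ∧
      (∀ v ∈ M₃, (∃ x ∈ X, R x v) ∧ ∃ x ∈ X, R v x) ∧
      DicolOn R M₁ γ ∧ DicolOn R M₂ γ ∧ DicolOn R M₃ k := by
  classical
  -- The relation `τ` is `R` for `P4` and its reverse for `A4`; these three facts are all that is
  -- used of it besides `hout` and `hin`.
  have hadj : ∀ {u v}, τ u v → Adjacent R u v := by
    rcases hτ with rfl | rfl
    · exact fun h => Or.inl h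
    · exact fun h => Or.inr h
  have hadj' : ∀ {u v}, Adjacent R u v → τ u v ∨ τ v u := by
    rcases hτ with rfl | rfl
    · exact fun h => h
    · exact fun h => h.symm
  have hτboth : ∀ {v a b}, τ v a → τ b v → (R a v ∧ R v b) ∨ (R b v ∧ R v a) := by
    rcases hτ with rfl | rfl
    · exact fun h1 h2 => Or.inr ⟨h2, h1⟩
    · exact fun h1 h2 => Or.inl ⟨h1, h2⟩
  clear hτ
  induction hX with
  | root =>
    have he : ∀ v, v ∉ (∅ : Set V) := Set.notMem_empty
    exact ⟨∅, ∅, ∅, Set.empty_subset _, Set.empty_subset _, Set.empty_subset _,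
      Set.subset_union_left, fun v hv => absurd hv (he v), fun v hv => absurd hv (he v),
      fun v hv => absurd hv (he v), DicolOn.of_empty he, DicolOn.of_empty he, DicolOn.of_empty he⟩
  | @ear X m w hX hw hm ih =>
    obtain ⟨M₁, M₂, M₃, h1X, h2X, h3X, hcov, h1, h2, h3, c1, c2, c3⟩ := ih
    set Y : Set V := X ∪ {v | ∃ i ≤ m, v = w i} with hY
    have hXY : X ⊆ Y := Set.subset_union_left
    have hNXY : Nbhd R X ⊆ Nbhd R Y := Nbhd.mono hXY
    have hwY : ∀ i ≤ m, w i ∈ Y := fun i hi => Or.inr ⟨i, hi, rfl⟩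
    let L₁ : Set V := {v | v ∉ Nbhd R X ∧ ∃ f ≤ m, τ (w f) v ∧ ∀ k < f, ¬ Adjacent R (w k) v}
    let L₂ : Set V := {v | v ∉ Nbhd R X ∧
      ∃ l ≤ m, τ v (w l) ∧ ∀ k, l < k → k ≤ m → ¬ Adjacent R (w k) v}
    let L₃ : Set V := BadOnEar R τ X m w
    -- The predecessor of `w f`, on the ear or in `X`, is adjacent to neither `u` nor `v`; with `w
    -- f`, `u`, `v` it would give the forbidden path. The next claim is the mirror image, with the
    -- successor of the last neighbour.
    have hL1 : ∀ u v f, u ∉ Nbhd R X → v ∉ Nbhd R X → f ≤ m → τ (w f) u →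
        (∀ k < f, ¬ Adjacent R (w k) u) → (∀ k ≤ f, ¬ Adjacent R (w k) v) → ¬ R u v := by
      intro u v f hu hv hf hfu hku hkv huv
      obtain ⟨p, hp, hpX | ⟨k, hk, rfl⟩⟩ := hw.exists_pred hf
      · exact hout p (w f) u v hp hfu huv (not_adjacent_of_notMem_nbhd hu hpX)
          (not_adjacent_of_notMem_nbhd hv hpX) (hkv f le_rfl)
      · exact hout (w k) (w f) u v hp hfu huv (hku k hk) (hkv k hk.le) (hkv f le_rfl)
    have hL2 : ∀ u v l, u ∉ Nbhd R X → v ∉ Nbhd R X → l ≤ m → τ v (w l) →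
        (∀ k, l < k → k ≤ m → ¬ Adjacent R (w k) v) →
        (∀ k, l ≤ k → k ≤ m → ¬ Adjacent R (w k) u) → ¬ R u v := by
      intro u v l hu hv hl hlv hkv hku huv
      have hs : ∀ {a b}, ¬ Adjacent R a b → ¬ Adjacent R b a := fun h h' => h h'.symm
      obtain ⟨p, hp, hpX | ⟨k, hk, hkm, rfl⟩⟩ := hw.exists_succ hl
      · exact hin u v (w l) p huv hlv hp (hs (hku l le_rfl hl))
          (hs (not_adjacent_of_notMem_nbhd hu hpX)) (hs (not_adjacent_of_notMem_nbhd hv hpX))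
      · exact hin u v (w l) (w k) huv hlv hp (hs (hku l le_rfl hl)) (hs (hku k hk.le hkm))
          (hs (hkv k hk hkm))
    have hnot : ∀ v, v ∉ Nbhd R Y → ∀ k ≤ m, ¬ Adjacent R (w k) v := fun v hv k hk =>
      not_adjacent_of_notMem_nbhd hv (hwY k hk)
    have hL1Y : L₁ ⊆ Nbhd R Y := fun v ⟨_, f, hf, hfv, _⟩ => ⟨w f, hwY f hf, hadj hfv⟩
    have hL2Y : L₂ ⊆ Nbhd R Y := fun v ⟨_, l, hl, hlv, _⟩ => ⟨w l, hwY l hl, (hadj hlv).symm⟩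
    have hL3Y : L₃ ⊆ Nbhd R Y := fun v ⟨_, f, l, _, hl, _, hlv, _⟩ => ⟨w l, hwY l hl, hadj hlv⟩
    refine ⟨M₁ ∪ L₁, M₂ ∪ L₂, M₃ ∪ L₃, Set.union_subset (h1X.trans hNXY) hL1Y,
      Set.union_subset (h2X.trans hNXY) hL2Y, Set.union_subset (h3X.trans hNXY) hL3Y,
      ?_, ?_, ?_, ?_, ?_, ?_, ?_⟩
    · intro v hv
      by_cases hvX : v ∈ Nbhd R X
      · rcases hcov hvX with h | (h | h) | h
        · exact Or.inl h
        · exact Or.inr (Or.inl (Or.inl (Or.inl h)))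
        · exact Or.inr (Or.inl (Or.inr (Or.inl h)))
        · exact Or.inr (Or.inr (Or.inl h))
      · have hex : ∃ i, i ≤ m ∧ Adjacent R (w i) v := by
          obtain ⟨x, hx | ⟨i, hi, rfl⟩, hxv⟩ := hv
          · exact absurd ⟨x, hx, hxv⟩ hvX
          · exact ⟨i, hi, hxv⟩
        have hf := Nat.find_spec hex
        have hfm : ∀ k < Nat.find hex, ¬ Adjacent R (w k) v := fun k hk h =>
          Nat.find_min hex hk ⟨hk.le.trans hf.1, h⟩
        set f := Nat.find hex
        obtain ⟨i, hi⟩ := hex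
        have hl := Nat.findGreatest_spec (P := fun i => Adjacent R (w i) v) hi.1 hi.2
        have hlm := Nat.findGreatest_le (P := fun i => Adjacent R (w i) v) m
        have hlg : ∀ k, Nat.findGreatest (fun i => Adjacent R (w i) v) m < k → k ≤ m →
          ¬ Adjacent R (w k) v := fun k h1 h2 => Nat.findGreatest_is_greatest h1 h2
        set l := Nat.findGreatest (fun i => Adjacent R (w i) v) m
        by_cases t1 : τ (w f) v
        · exact Or.inr (Or.inl (Or.inl (Or.inr ⟨hvX, f, hf.1, t1, hfm⟩)))
        by_cases t2 : τ v (w l)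
        · exact Or.inr (Or.inl (Or.inr (Or.inr ⟨hvX, l, hlm, t2, hlg⟩)))
        have t1' := (hadj' hf.2).resolve_left t1
        have t2' := (hadj' hl).resolve_right t2
        -- If the first and last neighbours coincide, the unfavourable direction for one is the
        -- favourable one for the other, so `f = l` cannot occur here.
        refine Or.inr (Or.inr (Or.inr ⟨hvX, f, l, ?_, hlm, t1', t2', hfm, hlg⟩))
        rcases lt_trichotomy f l with h | h | h
        · exact h
        · exact absurd (h ▸ t1') t2
        · exact absurd hl (hfm l h)
    · rintro u (hu | ⟨huX, f, hf, hfu, hku⟩) v hv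
      · exact h1 u hu v fun h => hv (hNXY h)
      · exact hL1 u v f huX (fun h => hv (hNXY h)) hf hfu hku
          fun k hk => hnot v hv k (hk.trans hf)
    · rintro v (hv | ⟨hvX, l, hl, hlv, hkv⟩) u hu
      · exact h2 v hv u fun h => hu (hNXY h)
      · exact hL2 u v l (fun h => hu (hNXY h)) hvX hl hlv hkv fun k _ hk => hnot u hu k hk
    · rintro v (hv | ⟨_, f, l, hfl, hl, hf, hl', _⟩)
      · obtain ⟨⟨x, hx, hxv⟩, y, hy, hvy⟩ := h3 v hv
        exact ⟨⟨x, hXY hx, hxv⟩, y, hXY hy, hvy⟩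
      · have hwf := hwY f (by omega)
        have hwl := hwY l hl
        rcases hτboth hf hl' with h | h
        · exact ⟨⟨_, hwf, h.1⟩, _, hwl, h.2⟩
        · exact ⟨⟨_, hwl, h.1⟩, _, hwf, h.2⟩
    · refine c1.glue ?_ fun u hu v hv => h1 u hu v hv.1
      have hL : ∀ v ∈ L₁, ∃ f ≤ m, τ (w f) v ∧ ∀ k < f, ¬ Adjacent R (w k) v := fun v hv => hv.2
      choose! f hfm hfτ hfk using hL
      -- By `hL1` the index of the first neighbour never increases along an arc, and each level lies
      -- in the neighbourhood of one ear vertex.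
      refine DicolOn.of_antitone f (fun u hu v hv huv => ?_) fun j => ?_
      · by_contra! hlt
        exact hL1 u v (f u) hu.1 hv.1 (hfm u hu) (hfτ u hu) (hfk u hu)
          (fun k hk => hfk v hv k (hk.trans_lt hlt)) huv
      · refine (hN (w j)).subset ?_
        rintro v ⟨hv, rfl⟩
        exact mem_nbhd_singleton (hadj (hfτ v hv))
    · rw [Set.union_comm]
      refine DicolOn.glue ?_ c2 fun u hu v hv => h2 v hv u hu.1
      have hL : ∀ v ∈ L₂, ∃ l ≤ m, τ v (w l) ∧ ∀ k, l < k → k ≤ m → ¬ Adjacent R (w k) v :=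
        fun v hv => hv.2
      choose! l hlm hlτ hlk using hL
      refine DicolOn.of_antitone l (fun u hu v hv huv => ?_) fun j => ?_
      · by_contra! hlt
        exact hL2 u v (l v) hu.1 hv.1 (hlm v hv) (hlτ v hv) (hlk v hv)
          (fun k hk hkm => hlk u hu k (hlt.trans_le hk) hkm) huv
      · refine (hN (w j)).subset ?_
        rintro v ⟨hv, rfl⟩
        exact mem_nbhd_singleton (hadj (hlτ v hv)).symm
    -- An old bad vertex outside `X` would be an ear by itself, forcing `m = 0`, but bad vertices
    -- need `f < l ≤ m`. Inside `X` it would make `v` adjacent to `X`.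
    · refine c3.glue (hbad X m w hw hm) fun u hu v hv huv => ?_
      obtain ⟨hvX, f, l, hfl, hl, _⟩ := hv
      obtain ⟨⟨x, hx, hxu⟩, y, hy, huy⟩ := h3 u hu
      by_cases huX : u ∈ X
      · exact hvX ⟨u, huX, Or.inl huv⟩
      · have := hw.min 0 u ⟨huX, x, hx, hxu⟩ ⟨huX, y, hy, huy⟩
        omega

/-- The colouring of a strongly connected set that can be grown from a vertex. -/
theorem Grown.dicolOn {R τ : V → V → Prop} {adm : ℕ → Prop} {r : V} {S : Set V} {γ k : ℕ}
    (hS : Grown R adm r S) (hγ : 0 < γ) (hτ : τ = R ∨ τ = Function.swap R)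
    (hout : ∀ p q u v, R p q → τ q u → R u v → ¬ Adjacent R p u → ¬ Adjacent R p v →
      ¬ Adjacent R q v → False)
    (hin : ∀ u v p q, R u v → τ v p → R p q → ¬ Adjacent R u p → ¬ Adjacent R u q →
      ¬ Adjacent R v q → False)
    (hN : ∀ v, DicolOn R (Nbhd R {v}) γ)
    (hbad : ∀ X m w, IsShortestEar R X m w → adm m → DicolOn R (BadOnEar R τ X m w) k) :
    DicolOn R S (3 * γ + k) := by
  obtain ⟨M₁, M₂, M₃, -, -, -, hcov, -, -, -, c1, c2, c3⟩ :=
    hS.exists_classes hτ hout hin hN hbad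
  have := (hN r).union ((c1.union c2).union c3)
  exact ((this.subset hcov).mono Set.Subset.rfl (by omega)).of_nbhd (by omega)

/-- On a shortest ear, the first neighbour of a bad vertex can increase along an arc by at most
two. -/
theorem IsShortestEar.dicolOn_badOnEar_swap {R : V → V → Prop} {X : Set V} {m : ℕ} {w : ℕ → V}
    {γ : ℕ} (hw : IsShortestEar R X m w) (hN : ∀ v, DicolOn R (Nbhd R {v}) γ) :
    DicolOn R (BadOnEar R (Function.swap R) X m w) (3 * γ) := by
  have hL : ∀ v ∈ BadOnEar R (Function.swap R) X m w,
      ∃ f l, f < l ∧ l ≤ m ∧ R (w f) v ∧ R v (w l) := by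
    rintro v ⟨_, f, l, hfl, hl, h1, h2, _⟩
    exact ⟨f, l, hfl, hl, h1, h2⟩
  have hX : ∀ v ∈ BadOnEar R (Function.swap R) X m w, v ∉ X := by
    intro v hv hvX
    obtain ⟨f, l, hfl, hl, _, h2⟩ := hL v hv
    have := hw.le_add (i := 0) ⟨(hw.out l hl).notMem, v, hvX, h2⟩ (hw.inLevel hl)
    omega
  choose! f l hfl hlm hf hl using hL
  -- Going out to `w (f u)`, through `u` and `v`, and back from `w (l v)` gives `l v ≤ f u + 3`, so
  -- `f v ≤ f u + 2`. Within one residue class modulo 3 the index therefore cannot increase.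
  have key : ∀ j, DicolOn R {v | v ∈ BadOnEar R (Function.swap R) X m w ∧ f v % 3 = j} γ := by
    intro j
    refine DicolOn.of_antitone f (fun u hu v hv huv => ?_) fun i => ?_
    · have hfu := hfl u hu.1
      have hfv := hfl v hv.1
      have hlu := hlm u hu.1
      have hlv := hlm v hv.1
      have h1 : OutLevel R X (f u + 1) u := ⟨hX u hu.1, _, hw.out (f u) (by omega), hf u hu.1⟩
      have h2 : OutLevel R X (f u + 1 + 1) v := ⟨hX v hv.1, u, h1, huv⟩
      have h3 : InLevel R X (m - l v + 1) v := ⟨hX v hv.1, _, hw.inLevel hlv, hl v hv.1⟩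
      have h4 := hw.le_add h2 h3
      have h5 := hu.2
      have h6 := hv.2
      omega
    · refine (hN (w i)).subset ?_
      rintro v ⟨hv, rfl⟩
      exact mem_nbhd_singleton (Or.inl (hf v hv.1))
  refine (((key 0).union (key 1)).union (key 2)).mono (fun v hv => ?_) (by omega)
  have h3 : f v % 3 = 0 ∨ f v % 3 = 1 ∨ f v % 3 = 2 := by omega
  rcases h3 with h | h | h
  · exact Or.inl (Or.inl ⟨hv, h⟩)
  · exact Or.inl (Or.inr ⟨hv, h⟩)
  · exact Or.inr ⟨hv, h⟩

/-- Since `f < l ≤ 2`, the first neighbour of a bad vertex is `w 0` or `w 1`. -/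
theorem dicolOn_badOnEar_of_le_two {R : V → V → Prop} {X : Set V} {m : ℕ} {w : ℕ → V} {γ : ℕ}
    (hm : m ≤ 2) (hN : ∀ v, DicolOn R (Nbhd R {v}) γ) :
    DicolOn R (BadOnEar R R X m w) (2 * γ) := by
  refine ((hN (w 0)).union (hN (w 1))).mono ?_ (by omega)
  rintro v ⟨_, f, l, hfl, hl, hf, _⟩
  have : f = 0 ∨ f = 1 := by omega
  rcases this with rfl | rfl
  · exact Or.inl (mem_nbhd_singleton (Or.inr hf))
  · exact Or.inr (mem_nbhd_singleton (Or.inr hf))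

theorem IsShortestEar.union_not_subset {R : V → V → Prop} {X : Set V} {m : ℕ} {w : ℕ → V}
    (hw : IsShortestEar R X m w) : ¬ X ∪ {v | ∃ i ≤ m, v = w i} ⊆ X := fun h =>
  (hw.out 0 (Nat.zero_le m)).notMem (h (Or.inr ⟨0, Nat.zero_le m, rfl⟩))

/-! ### The case `A4`: all shortest ears are admissible. -/

theorem A4Free.dicolOn_strong [Finite V] {R : V → V → Prop} {S : Set V} {γ : ℕ}
    (hF : A4Free R) (hγ : 0 < γ) (hS : StrongOn R S) (hne : S.Nonempty)
    (hN : ∀ v, DicolOn R (Nbhd R {v}) γ) : DicolOn R S (6 * γ) := by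
  obtain ⟨r, hr⟩ := hne
  obtain ⟨X, _, hX⟩ := Finite.exists_le_maximal (Grown.root (R := R) (adm := fun _ => True) (r := r))
  have hSX : S ⊆ X := by
    intro y hy
    by_contra hyX
    obtain ⟨m, w, hw⟩ := hS.exists_isShortestEar hX.prop.root_mem hr hy hyX
    exact hw.union_not_subset (hX.le_of_ge (hX.prop.ear hw trivial) Set.subset_union_left)
  have := hX.prop.dicolOn (τ := Function.swap R) hγ (Or.inr rfl)
    (fun p q u v h1 h2 h3 h4 h5 h6 => hF v u q p h3 h2 h1 (fun h => h6 h.symm)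
      (fun h => h5 h.symm) fun h => h4 h.symm)
    (fun u v p q h1 h2 h3 h4 h5 h6 => by
      exact hF q p v u h3 h2 h1 (fun h => h6 h.symm) (fun h => h5 h.symm) fun h => h4 h.symm) hN
    (fun X m w hw _ => hw.dicolOn_badOnEar_swap hN)
  exact this.mono hSX (by omega)

/-! ### The case `P4`: short ears suffice. -/

/-- If `v` has an in-neighbour but no out-neighbour in a strongly connected set and an
out-neighbour that is not adjacent to the set, then every vertex of the set sends an arc to `v`. -/
theorem P4Free.complete_of_arc_out {R : V → V → Prop} {adm : ℕ → Prop} {r : V} {X : Set V}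
    (hF : P4Free R) (hX : Grown R adm r X) {x v z : V} (hx : x ∈ X) (hxv : R x v)
    (hv : ∀ y ∈ X, ¬ R v y) (hvz : R v z) (hz : z ∉ Nbhd R X) : ∀ y ∈ X, R y v := by
  refine hX.forall_of_pred_closed hx hxv fun a ha b hb hab hbv => ?_
  by_contra hav
  exact hF a b v z hab hbv hvz (fun h => h.elim hav (hv a ha))
    (not_adjacent_of_notMem_nbhd hz ha) (not_adjacent_of_notMem_nbhd hz hb)

/-- In the absence of an induced directed path on four vertices, ears with at most three inner
vertices suffice to grow a strongly connected set. -/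
theorem P4Free.exists_grown [Finite V] {R : V → V → Prop} {S : Set V} (hF : P4Free R)
    (hS : StrongOn R S) (hne : S.Nonempty) : ∃ r X, Grown R (· ≤ 2) r X ∧ S ⊆ X := by
  obtain ⟨r₀, hr₀⟩ := hne
  -- Maximality is over all roots in `S`, so that a set grown from another root can contradict it.
  obtain ⟨X, hX₀, hX⟩ := Finite.exists_le_maximal (p := fun X => ∃ r, r ∈ S ∧ Grown R (· ≤ 2) r X)
    ⟨r₀, hr₀, Grown.root⟩
  obtain ⟨⟨r, hr, hrX⟩, hmax⟩ := hX
  refine ⟨r, X, hrX, fun y hy => ?_⟩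
  by_contra hyX
  obtain ⟨m, w, hw⟩ := hS.exists_isShortestEar hrX.root_mem hr hy hyX
  have hm : 3 ≤ m := by
    by_contra! h
    exact hw.union_not_subset (hmax ⟨r, hr, hrX.ear hw (by omega)⟩ Set.subset_union_left)
  have hw0 : ∀ x ∈ X, ¬ R (w 0) x := fun x hx h => by
    have := hw.min 0 _ (hw.out 0 (by omega)) ⟨(hw.out 0 (by omega)).notMem, x, hx, h⟩
    omega
  have hmid : ∀ i, 1 ≤ i → i < m → w i ∉ Nbhd R X := by
    rintro i h1 h2 ⟨x, hx, h | h⟩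
    · have := hw.le_add (i := 0) ⟨(hw.out i h2.le).notMem, x, hx, h⟩ (hw.inLevel h2.le)
      omega
    · have := hw.min i _ (hw.out i h2.le) ⟨(hw.out i h2.le).notMem, x, hx, h⟩
      omega
  have hjump : ∀ i, 2 ≤ i → i ≤ m → ¬ R (w 0) (w i) := fun i h1 h2 h => by
    have := hw.le_add (i := 1) ⟨(hw.out i h2).notMem, _, hw.out 0 (by omega), h⟩ (hw.inLevel h2)
    omega
  have h01 : R (w 0) (w 1) := hw.arc 0 (by omega)
  have h12 : R (w 1) (w 2) := hw.arc 1 (by omega)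
  obtain ⟨-, x₀, hx₀, hx₀w⟩ := hw.out 0 (by omega)
  have hcomp : ∀ x ∈ X, R x (w 0) :=
    hF.complete_of_arc_out hrX hx₀ hx₀w hw0 h01 (hmid 1 le_rfl (by omega))
  have h20 : R (w 2) (w 0) := by
    by_contra h
    exact hF x₀ (w 0) (w 1) (w 2) hx₀w h01 h12
      (not_adjacent_of_notMem_nbhd (hmid 1 le_rfl (by omega)) hx₀)
      (not_adjacent_of_notMem_nbhd (hmid 2 (by omega) (by omega)) hx₀)
      (fun h' => h'.elim (hjump 2 le_rfl (by omega)) h)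
  have hw0S : w 0 ∈ S := (hS.supported _ _ h01).1
  -- A second grown set is started at `w 0`, which lies on the directed triangle `w 0`, `w 1`, `w
  -- 2`. By maximality no ear with at most three inner vertices returns to it.
  obtain ⟨X', hX'₀, hX'⟩ := Finite.exists_le_maximal
    (Grown.root (R := R) (adm := (· ≤ 2)) (r := w 0))
  have hw0X' : w 0 ∈ X' := hX'.prop.root_mem
  have hcl : ∀ n v, n ≤ 2 → OutLevel R X' n v → ¬ InLevel R X' 0 v := by
    intro n v hn h1 h2
    obtain ⟨m', w', hw'⟩ := exists_isShortestEar ⟨n, v, h1, h2⟩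
    exact hw'.union_not_subset (hX'.le_of_ge
      (hX'.prop.ear hw' ((hw'.min n v h1 h2).trans hn)) Set.subset_union_left)
  have no0 : ∀ p v q, p ∈ X' → v ∉ X' → q ∈ X' → R p v → R v q → False :=
    fun p v q hp hv hq h1 h2 => hcl 0 v (by omega) ⟨hv, p, hp, h1⟩ ⟨hv, q, hq, h2⟩
  have no1 : ∀ p u v q, p ∈ X' → u ∉ X' → v ∉ X' → q ∈ X' → R p u → R u v → R v q → False :=
    fun p u v q hp hu hv hq h1 h2 h3 =>
      hcl 1 v (by omega) ⟨hv, u, ⟨hu, p, hp, h1⟩, h2⟩ ⟨hv, q, hq, h3⟩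
  have hw1X' : w 1 ∈ X' := by
    by_contra h1
    by_cases h2 : w 2 ∈ X'
    · exact no0 _ _ _ hw0X' h1 h2 h01 h12
    · exact no1 _ _ _ _ hw0X' h1 h2 hw0X' h01 h12 h20
  -- All of `X` sends arcs to `w 0`, so once `X'` meets `X` it absorbs `X`, and `w 0` makes it
  -- strictly larger.
  have hdisj : ∀ x ∈ X, x ∉ X' := by
    intro x hx hxX'
    have hXX' : X ⊆ X' := by
      refine hrX.forall_of_succ_closed (Z := (· ∈ X')) hx hxX' fun a _ b hb hab ha => ?_
      by_contra hbX'
      exact no0 a b (w 0) ha hbX' hw0X' hab (hcomp b hb)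
    exact (hw.out 0 (by omega)).notMem (hmax ⟨w 0, hw0S, hX'.prop⟩ hXX' hw0X')
  obtain ⟨-, x₁, hx₁, hwx₁⟩ := hw.last
  let Q : ℕ → Prop := fun i => w i ∈ X' ∨ ∃ p ∈ X', R p (w i)
  have hQm : ¬ Q m := by
    have hm1 : w m ∉ X' := fun h =>
      no0 (w m) x₁ (w 0) h (hdisj x₁ hx₁) hw0X' hwx₁ (hcomp x₁ hx₁)
    rintro (h | ⟨p, hp, h⟩)
    · exact hm1 h
    · exact no1 p (w m) x₁ (w 0) hp hm1 (hdisj x₁ hx₁) hw0X' h hwx₁ (hcomp x₁ hx₁)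
  -- At the place where the ear moves away from `X'`, `w i` is an out-neighbour of `X'` and `w (i +
  -- 1)` is not adjacent to `X'`. Then all of `X'`, in particular `w 0`, sends arcs to `w i`, a
  -- shortcut on the shortest ear.
  obtain ⟨i, hi1, him, hQi, hQi'⟩ : ∃ i, 1 ≤ i ∧ i < m ∧ Q i ∧ ¬ Q (i + 1) := by
    by_contra! h
    have : ∀ i, 1 ≤ i → i ≤ m → Q i := by
      intro i h1
      induction i, h1 using Nat.le_induction with
      | base => exact fun _ => Or.inl hw1X'
      | succ i h1 ih => exact fun h2 => h i h1 (by omega) (ih (by omega))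
    exact hQm (this m (by omega) le_rfl)
  have harc := hw.arc i him
  have hiX' : w i ∉ X' := fun h => hQi' (Or.inr ⟨w i, h, harc⟩)
  obtain ⟨p, hp, hpi⟩ := hQi.resolve_left hiX'
  have hi2 : 2 ≤ i := by
    by_contra! h
    obtain rfl : i = 1 := by omega
    exact hiX' hw1X'
  have hi'X' : w (i + 1) ∉ X' := fun h => hQi' (Or.inl h)
  have hnext : w (i + 1) ∉ Nbhd R X' := by
    rintro ⟨q, hq, h | h⟩
    · exact hQi' (Or.inr ⟨q, hq, h⟩)
    · exact no1 p _ _ q hp hiX' hi'X' hq hpi harc h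
  exact hjump i hi2 him.le (hF.complete_of_arc_out hX'.prop hp hpi
    (fun q hq h => no0 p _ q hp hiX' hq hpi h) harc hnext (w 0) hw0X')

theorem P4Free.dicolOn_strong [Finite V] {R : V → V → Prop} {S : Set V} {γ : ℕ}
    (hF : P4Free R) (hγ : 0 < γ) (hS : StrongOn R S) (hne : S.Nonempty)
    (hN : ∀ v, DicolOn R (Nbhd R {v}) γ) : DicolOn R S (5 * γ) := by
  obtain ⟨r, X, hX, hSX⟩ := hF.exists_grown hS hne
  have := hX.dicolOn (τ := R) hγ (Or.inl rfl)
    (fun p q u v h1 h2 h3 h4 h5 h6 => hF p q u v h1 h2 h3 h4 h5 h6)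
    (fun u v p q h1 h2 h3 h4 h5 h6 => hF u v p q h1 h2 h3 h4 h5 h6) hN
    (fun X m w _ hm => dicolOn_badOnEar_of_le_two hm hN)
  exact this.mono hSX (by omega)

/-! ### Transfer to digraphs and explicit bounds. -/

namespace Digraph

theorem transGen_of_cyclic {V : Type u} {Q : V → V → Prop} {n : ℕ}
    {p : Fin (n + 1) → V} (h : ∀ i, Q (p i) (p (i + 1))) : TransGen Q (p 0) (p 0) := by
  have hsucc : ∀ i : ℕ, Fin.ofNat (n + 1) i + 1 = Fin.ofNat (n + 1) (i + 1) := fun i => by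
    ext; simp [Fin.val_add]
  have key : ∀ i : ℕ, TransGen Q (p 0) (p (Fin.ofNat (n + 1) (i + 1))) := by
    intro i
    induction i with
    | zero => rw [← hsucc]; exact TransGen.single (h 0)
    | succ i ih => rw [← hsucc]; exact ih.tail (h _)
  have h0 : Fin.ofNat (n + 1) (n + 1) = 0 := by ext; simp
  exact h0 ▸ key n

theorem dichromaticNumber_le_of_dicolOn {V : Type u} {D : Digraph V} {k : ℕ}
    (h : DicolOn D.Adj Set.univ k) : D.dichromaticNumber ≤ k := by
  obtain ⟨c, hc, ha⟩ := h
  refine Nat.sInf_le ⟨fun v => ⟨c v, hc v trivial⟩, fun n p hp => ?_⟩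
  by_contra! hmono
  refine ha (p 0) (transGen_of_cyclic fun i => ⟨hp.2 i, trivial, trivial, ?_⟩)
  exact congrArg Fin.val (hmono i (i + 1))

theorem cliqueLE_cliqueNumber {V : Type u} [Finite V] (D : Digraph V) :
    CliqueLE D.Adj D.cliqueNumber := by
  intro s hs
  refine SimpleGraph.IsClique.card_le_cliqueNum (G := D.toSimpleGraphInclusive) (t := s)
    (tc := fun u hu v hv huv => ⟨huv, hs u hu v hv huv⟩)

/-- An induced path on four vertices gives an induced copy of each digraph with the same arcs. -/
theorem contains_of_path {V : Type u} {D : Digraph V} (H : Digraph (Fin 4)) {a b c d : V}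
    (hD : D.IsOriented) (hab : Adjacent D.Adj a b) (hbc : Adjacent D.Adj b c)
    (hcd : Adjacent D.Adj c d) (hac : ¬ Adjacent D.Adj a c) (had : ¬ Adjacent D.Adj a d)
    (hbd : ¬ Adjacent D.Adj b d)
    (h : ∀ i j, D.Adj (![a, b, c, d] i) (![a, b, c, d] j) ↔ H.Adj i j) : D.Contains H := by
  have hne : ∀ {u v}, Adjacent D.Adj u v → u ≠ v := fun h => Oriented.ne hD h
  have h1 := hne hab
  have h2 := hne hbc
  have h3 := hne hcd
  have h4 : a ≠ c := by rintro rfl; exact had hcd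
  have h5 : b ≠ d := by rintro rfl; exact had hab
  have h6 : a ≠ d := by rintro rfl; exact hbd hab.symm
  refine ⟨⟨⟨![a, b, c, d], ?_⟩, h _ _⟩⟩
  intro i j hij
  fin_cases i <;> fin_cases j <;> simp_all [eq_comm]

theorem IsFree.p4Free {V : Type u} {D : Digraph V} (hD : D.IsOriented) (h : D.IsFree P4) :
    P4Free D.Adj := by
  intro a b c d hab hbc hcd hac had hbd
  refine h (contains_of_path P4 hD (Or.inl hab) (Or.inl hbc) (Or.inl hcd) hac had hbd ?_)
  have hl : ∀ v, ¬ D.Adj v v := fun v h => hD v v h h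
  have := hD _ _ hab
  have := hD _ _ hbc
  have := hD _ _ hcd
  simp only [Adjacent, not_or] at hac had hbd
  intro i j
  fin_cases i <;> fin_cases j <;> simp_all [P4]

theorem IsFree.a4Free {V : Type u} {D : Digraph V} (hD : D.IsOriented) (h : D.IsFree A4) :
    A4Free D.Adj := by
  intro a b c d hba hbc hdc hac had hbd
  refine h (contains_of_path A4 hD (Or.inr hba) (Or.inl hbc) (Or.inr hdc) hac had hbd ?_)
  have hl : ∀ v, ¬ D.Adj v v := fun v h => hD v v h h
  have := hD _ _ hba
  have := hD _ _ hbc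
  have := hD _ _ hdc
  simp only [Adjacent, not_or] at hac had hbd
  intro i j
  fin_cases i <;> fin_cases j <;> simp_all [A4]

theorem IsFree.q4Free {V : Type u} {D : Digraph V} (hD : D.IsOriented) (h : D.IsFree Q4) :
    Q4Free D.Adj := by
  intro a b c d hab hcb hdc hac had hbd
  refine h (contains_of_path Q4 hD (Or.inl hab) (Or.inr hcb) (Or.inr hdc) hac had hbd ?_)
  have hl : ∀ v, ¬ D.Adj v v := fun v h => hD v v h h
  have := hD _ _ hab
  have := hD _ _ hcb
  have := hD _ _ hdc
  simp only [Adjacent, not_or] at hac had hbd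
  intro i j
  fin_cases i <;> fin_cases j <;> simp_all [Q4]

theorem IsFree.q4Free_swap {V : Type u} {D : Digraph V} (hD : D.IsOriented) (h : D.IsFree Q4') :
    Q4Free (Function.swap D.Adj) := by
  intro a b c d hba hbc hcd hac had hbd
  simp only [Function.swap] at hba hbc hcd
  simp only [Adjacent, Function.swap, not_or] at hac had hbd
  refine h (contains_of_path Q4' hD (a := d) (b := c) (c := b) (d := a) (Or.inr hcd) (Or.inr hbc)
    (Or.inl hba) (by simp [Adjacent, hbd]) (by simp [Adjacent, had]) (by simp [Adjacent, hac]) ?_)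
  have hl : ∀ v, ¬ D.Adj v v := fun v h => hD v v h h
  have := hD _ _ hba
  have := hD _ _ hbc
  have := hD _ _ hcd
  intro i j
  fin_cases i <;> fin_cases j <;> simp_all [Q4']

section Bounds
variable {V : Type u} [Finite V] {D : Digraph V}

/-- The slack of one fits the form of `dicolOn_pow_of_strong` and covers clique number zero without
a separate case. -/
theorem cliqueLE_succ (D : Digraph V) : CliqueLE D.Adj (D.cliqueNumber + 1) :=
  fun s hs => (D.cliqueLE_cliqueNumber s hs).trans (Nat.le_succ _)

theorem IsFree.dichromaticNumber_le_p4 (hD : D.IsOriented) (h : D.IsFree P4) :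
    D.dichromaticNumber ≤ 5 ^ D.cliqueNumber :=
  dichromaticNumber_le_of_dicolOn <| dicolOn_pow_of_strong (by norm_num) P4Free
    (fun _ S h => h.restr S) (fun _ _ _ hγ _ hF hS hne hN => hF.dicolOn_strong hγ hS hne hN) _ _
    hD (h.p4Free hD) D.cliqueLE_succ

theorem IsFree.dichromaticNumber_le_a4 (hD : D.IsOriented) (h : D.IsFree A4) :
    D.dichromaticNumber ≤ 6 ^ D.cliqueNumber :=
  dichromaticNumber_le_of_dicolOn <| dicolOn_pow_of_strong (by norm_num) A4Free
    (fun _ S h => h.restr S) (fun _ _ _ hγ _ hF hS hne hN => hF.dicolOn_strong hγ hS hne hN) _ _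
    hD (h.a4Free hD) D.cliqueLE_succ

theorem IsFree.dichromaticNumber_le_q4 (hD : D.IsOriented) (h : D.IsFree Q4) :
    D.dichromaticNumber ≤ 2 ^ D.cliqueNumber :=
  dichromaticNumber_le_of_dicolOn <| dicolOn_pow_of_strong (by norm_num) Q4Free
    (fun _ S h => h.restr S) (fun _ _ _ hγ _ hF hS hne hN => hF.dicolOn_strong hγ hS hne hN) _ _
    hD (h.q4Free hD) D.cliqueLE_succ

theorem IsFree.dichromaticNumber_le_q4' (hD : D.IsOriented) (h : D.IsFree Q4') :
    D.dichromaticNumber ≤ 2 ^ D.cliqueNumber :=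
  dichromaticNumber_le_of_dicolOn <| DicolOn.of_swap <|
    dicolOn_pow_of_strong (by norm_num) Q4Free (fun _ S h => h.restr S)
      (fun _ _ _ hγ _ hF hS hne hN => hF.dicolOn_strong hγ hS hne hN) _ _
      (fun u v h => hD v u h) (h.q4Free_swap hD)
      fun s hs => D.cliqueLE_succ s fun u hu v hv huv => (hs u hu v hv huv).symm

end Bounds

theorem IsFree.of_iso {V : Type u} {D : Digraph V} {H H' : Digraph (Fin 4)} (h : D.IsFree H)
    (e : Fin 4 ≃ Fin 4) (he : ∀ i j, H'.Adj (e i) (e j) ↔ H.Adj i j) : D.IsFree H' :=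
  fun ⟨f⟩ => h ⟨(RelIso.toRelEmbedding ⟨e, he _ _⟩).trans f⟩

/-- Up to isomorphism the path on four vertices has four orientations. -/
theorem IsFree.of_isOrientationOf_pathGraph {V : Type u} {D : Digraph V} {H : Digraph (Fin 4)}
    (hH : H.IsOrientationOf (SimpleGraph.pathGraph 4)) (h : D.IsFree H) :
    D.IsFree P4 ∨ D.IsFree A4 ∨ D.IsFree Q4 ∨ D.IsFree Q4' := by
  obtain ⟨hO, hG⟩ := hH
  have hl : ∀ v, ¬ H.Adj v v := fun v h => hO v v h h
  have hadj : ∀ i j, (SimpleGraph.pathGraph 4).Adj i j → H.Adj i j ∨ H.Adj j i := by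
    intro i j hij
    rw [← hG] at hij
    exact hij.2
  have hnadj : ∀ i j, i ≠ j → ¬ (SimpleGraph.pathGraph 4).Adj i j → ¬ H.Adj i j := by
    intro i j hij hn h
    rw [← hG] at hn
    exact hn ⟨hij, Or.inl h⟩
  have h01 := hadj 0 1 (by simp [SimpleGraph.pathGraph_adj])
  have h12 := hadj 1 2 (by simp [SimpleGraph.pathGraph_adj])
  have h23 := hadj 2 3 (by simp [SimpleGraph.pathGraph_adj])
  have h02 := hnadj 0 2 (by decide) (by simp [SimpleGraph.pathGraph_adj])
  have h20 := hnadj 2 0 (by decide) (by simp [SimpleGraph.pathGraph_adj])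
  have h03 := hnadj 0 3 (by decide) (by simp [SimpleGraph.pathGraph_adj])
  have h30 := hnadj 3 0 (by decide) (by simp [SimpleGraph.pathGraph_adj])
  have h13 := hnadj 1 3 (by decide) (by simp [SimpleGraph.pathGraph_adj])
  have h31 := hnadj 3 1 (by decide) (by simp [SimpleGraph.pathGraph_adj])
  have hl0 := hl 0
  have hl1 := hl 1
  have hl2 := hl 2
  have hl3 := hl 3
  clear hadj hnadj hl hG
  -- Of the eight orientations, reversing the order of the vertices identifies pairs, leaving each
  -- of the four types twice.
  rcases h01 with a | a <;> rcases h12 with b | b <;> rcases h23 with c | c <;>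
    have a' := hO _ _ a <;> have b' := hO _ _ b <;> have c' := hO _ _ c
  · exact Or.inl (h.of_iso (Equiv.refl _) (by
      intro i j; fin_cases i <;> fin_cases j <;> simp [P4, *]))
  · exact Or.inr (Or.inr (Or.inl (h.of_iso Fin.revPerm (by
      intro i j; fin_cases i <;> fin_cases j <;> simp [Q4, Fin.rev, *]))))
  · exact Or.inr (Or.inl (h.of_iso Fin.revPerm (by
      intro i j; fin_cases i <;> fin_cases j <;> simp [A4, Fin.rev, *])))
  · exact Or.inr (Or.inr (Or.inl (h.of_iso (Equiv.refl _) (by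
      intro i j; fin_cases i <;> fin_cases j <;> simp [Q4, *]))))
  · exact Or.inr (Or.inr (Or.inr (h.of_iso Fin.revPerm (by
      intro i j; fin_cases i <;> fin_cases j <;> simp [Q4', Fin.rev, *]))))
  · exact Or.inr (Or.inl (h.of_iso (Equiv.refl _) (by
      intro i j; fin_cases i <;> fin_cases j <;> simp [A4, *])))
  · exact Or.inr (Or.inr (Or.inr (h.of_iso (Equiv.refl _) (by
      intro i j; fin_cases i <;> fin_cases j <;> simp [Q4', *]))))
  · exact Or.inl (h.of_iso Fin.revPerm (by
      intro i j; fin_cases i <;> fin_cases j <;> simp [P4, Fin.rev, *]))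

theorem IsFree.dichromaticNumber_le_of_isOrientationOf {V : Type u} [Finite V] {D : Digraph V}
    {H : Digraph (Fin 4)} (hH : H.IsOrientationOf (SimpleGraph.pathGraph 4)) (hD : D.IsOriented)
    (h : D.IsFree H) : D.dichromaticNumber ≤ 6 ^ D.cliqueNumber := by
  have h2 : 2 ^ D.cliqueNumber ≤ 6 ^ D.cliqueNumber := Nat.pow_le_pow_left (by norm_num) _
  have h5 : 5 ^ D.cliqueNumber ≤ 6 ^ D.cliqueNumber := Nat.pow_le_pow_left (by norm_num) _
  rcases h.of_isOrientationOf_pathGraph hH with h | h | h | h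
  · exact (h.dichromaticNumber_le_p4 hD).trans h5
  · exact h.dichromaticNumber_le_a4 hD
  · exact (h.dichromaticNumber_le_q4 hD).trans h2
  · exact (h.dichromaticNumber_le_q4' hD).trans h2

/-! ### Excluding a transitive tournament. -/

/-- A tournament on at least `2 ^ k` vertices contains a transitive tournament on `k` vertices. -/
theorem exists_transitive_list {V : Type u} {R : V → V → Prop} (k : ℕ) : ∀ s : Finset V,
    (∀ u ∈ s, ∀ v ∈ s, u ≠ v → Adjacent R u v) → 2 ^ k ≤ s.card →
    ∃ l : List V, l.length = k ∧ l.Pairwise R ∧ ∀ v ∈ l, v ∈ s := by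
  classical
  induction k with
  | zero => exact fun s _ _ => ⟨[], rfl, List.Pairwise.nil, fun v hv => by simp at hv⟩
  | succ k ih =>
    intro s hs hcard
    obtain ⟨v, hv⟩ : s.Nonempty := Finset.card_pos.1 (lt_of_lt_of_le (by positivity) hcard)
    have hsplit : (s.erase v).card ≤ (s.filter (R v ·)).card + (s.filter (R · v)).card := by
      refine (Finset.card_le_card fun w hw => ?_).trans (Finset.card_union_le _ _)
      obtain ⟨hwv, hws⟩ := Finset.mem_erase.1 hw
      rw [Finset.mem_union, Finset.mem_filter, Finset.mem_filter]
      exact (hs v hv w hws hwv.symm).imp (fun h => ⟨hws, h⟩) fun h => ⟨hws, h⟩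
    rw [Finset.card_erase_of_mem hv] at hsplit
    rw [pow_succ] at hcard
    have hor : 2 ^ k ≤ (s.filter (R v ·)).card ∨ 2 ^ k ≤ (s.filter (R · v)).card := by omega
    rcases hor with h | h
    · obtain ⟨l, hl, hp, hm⟩ := ih _ (fun a ha b hb => hs a (Finset.mem_filter.1 ha).1 b
        (Finset.mem_filter.1 hb).1) h
      refine ⟨v :: l, by simp [hl], List.pairwise_cons.2
        ⟨fun w hw => (Finset.mem_filter.1 (hm w hw)).2, hp⟩, fun w hw => ?_⟩
      rcases List.mem_cons.1 hw with rfl | hw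
      · exact hv
      · exact (Finset.mem_filter.1 (hm w hw)).1
    · obtain ⟨l, hl, hp, hm⟩ := ih _ (fun a ha b hb => hs a (Finset.mem_filter.1 ha).1 b
        (Finset.mem_filter.1 hb).1) h
      refine ⟨l ++ [v], by simp [hl], List.pairwise_append.2 ⟨hp, List.pairwise_singleton _ _,
        fun w hw x hx => ?_⟩, fun w hw => ?_⟩
      · rw [List.mem_singleton.1 hx]
        exact (Finset.mem_filter.1 (hm w hw)).2
      · rcases List.mem_append.1 hw with hw | hw
        · exact (Finset.mem_filter.1 (hm w hw)).1
        · rw [List.mem_singleton.1 hw]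
          exact hv

theorem IsFree.cliqueNumber_le_of_transitiveTournament {V : Type u} [Finite V] {D : Digraph V}
    (hD : D.IsOriented) {k : ℕ} (h : D.IsFree (transitiveTournament k)) :
    D.cliqueNumber ≤ 2 ^ k := by
  by_contra! hlt
  obtain ⟨s, hs⟩ := D.toSimpleGraphInclusive.exists_isNClique_cliqueNum
  obtain ⟨l, hl, hp, -⟩ := exists_transitive_list (R := D.Adj) k s
    (fun u hu v hv huv => (hs.isClique hu hv huv).2) (hs.card_eq ▸ hlt.le)
  subst hl
  have hlt : ∀ i j : Fin l.length, i < j → D.Adj (l.get i) (l.get j) :=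
    fun i j hij => List.pairwise_iff_get.1 hp i j hij
  refine h ⟨⟨⟨l.get, fun i j hij => ?_⟩, @fun i j => ⟨fun hij => ?_, hlt i j⟩⟩⟩
  · rcases lt_trichotomy i j with h' | h' | h'
    · exact absurd (hlt i j h') fun h => hD _ _ h (by rw [hij] at h ⊢; exact h)
    · exact h'
    · exact absurd (hlt j i h') fun h => hD _ _ h (by rw [hij] at h ⊢; exact h)
  · have hij' : D.Adj (l.get i) (l.get j) := hij
    change i < j
    rcases lt_trichotomy i j with h' | rfl | h'
    · exact h'
    · exact absurd hij' (hD _ _ hij')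
    · exact absurd (hlt j i h') (hD _ _ hij')

end Digraph

/-- Passes from the exponential bound to the stated form: the base is at least one, so enlarging
base and exponent is harmless. -/
theorem natCast_pow_le_rpow {c n s : ℕ} {e : ℝ} (he : 0 ≤ e) (hc : c ≤ n + s) (hs : 1 ≤ s)
    {d : ℕ} (hd : d ≤ c ^ n) : (d : ℝ) ≤ ((n : ℝ) + s) ^ ((n : ℝ) + e) := by
  have h1 : (1 : ℝ) ≤ (n : ℝ) + s := by exact_mod_cast (by omega : 1 ≤ n + s)
  calc (d : ℝ) ≤ (c : ℝ) ^ n := by exact_mod_cast hd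
    _ ≤ ((n : ℝ) + s) ^ n := by gcongr; exact_mod_cast hc
    _ = ((n : ℝ) + s) ^ (n : ℝ) := (Real.rpow_natCast _ _).symm
    _ ≤ ((n : ℝ) + s) ^ ((n : ℝ) + e) := Real.rpow_le_rpow_of_exponent_le h1 (by linarith)

end

theorem theorem1 :
    -- every orientation of the path on four vertices is `χ⃗`-bounding
    (∀ H : Digraph (Fin 4), H.IsOrientationOf (SimpleGraph.pathGraph 4) →
      Digraph.IsDichiBounding.{u} H) ∧
    -- the explicit bounds for each orientation
    (∀ (V : Type u) [Finite V] (D : Digraph V), D.IsOriented →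
      ((D.IsFree Digraph.Q4 ∨ D.IsFree Digraph.Q4') →
        (D.dichromaticNumber : ℝ) ≤
          ((D.cliqueNumber : ℝ) + 3) ^ ((D.cliqueNumber : ℝ) + 9 / 2)) ∧
      (D.IsFree Digraph.P4 →
        (D.dichromaticNumber : ℝ) ≤
          ((D.cliqueNumber : ℝ) + 6) ^ ((D.cliqueNumber : ℝ) + 15 / 2)) ∧
      (D.IsFree Digraph.A4 →
        (D.dichromaticNumber : ℝ) ≤
          ((D.cliqueNumber : ℝ) + 7) ^ ((D.cliqueNumber : ℝ) + 17 / 2))) ∧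
    -- the bound common to all orientations
    (∀ H : Digraph (Fin 4), H.IsOrientationOf (SimpleGraph.pathGraph 4) →
      ∀ (V : Type u) [Finite V] (D : Digraph V), D.IsOriented → D.IsFree H →
        (D.dichromaticNumber : ℝ) ≤
          ((D.cliqueNumber : ℝ) + 7) ^ ((D.cliqueNumber : ℝ) + 17 / 2)) ∧
    -- forbidding in addition a transitive tournament bounds the dichromatic number
    (∀ H : Digraph (Fin 4), H.IsOrientationOf (SimpleGraph.pathGraph 4) → ∀ k : ℕ,
      ∃ C : ℕ, ∀ (V : Type u) [Finite V] (D : Digraph V), D.IsOriented → D.IsFree H →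
        D.IsFree (Digraph.transitiveTournament k) → D.dichromaticNumber ≤ C) := by

  have bound : ∀ H : Digraph (Fin 4), H.IsOrientationOf (SimpleGraph.pathGraph 4) →
      ∀ (V : Type u) [Finite V] (D : Digraph V), D.IsOriented → D.IsFree H →
        D.dichromaticNumber ≤ 6 ^ D.cliqueNumber :=
    fun H hH V _ D hD h => h.dichromaticNumber_le_of_isOrientationOf hH hD
  refine ⟨fun H hH => ⟨fun n => 6 ^ n, fun V _ D hD => bound H hH V D hD.1 hD.2⟩,
    fun V _ D hD => ⟨fun h => ?_, fun h => ?_, fun h => ?_⟩, fun H hH V _ D hD h => ?_,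
    fun H hH k => ⟨6 ^ 2 ^ k, fun V _ D hD h hk => ?_⟩⟩
  · exact_mod_cast natCast_pow_le_rpow (c := 2) (s := 3) (e := 9 / 2) (by norm_num) (by omega)
      (by norm_num) (h.elim (fun h => h.dichromaticNumber_le_q4 hD)
        fun h => h.dichromaticNumber_le_q4' hD)
  · exact_mod_cast natCast_pow_le_rpow (c := 5) (s := 6) (e := 15 / 2) (by norm_num) (by omega)
      (by norm_num) (h.dichromaticNumber_le_p4 hD)
  · exact_mod_cast natCast_pow_le_rpow (c := 6) (s := 7) (e := 17 / 2) (by norm_num) (by omega)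
      (by norm_num) (h.dichromaticNumber_le_a4 hD)
  · exact_mod_cast natCast_pow_le_rpow (c := 6) (s := 7) (e := 17 / 2) (by norm_num) (by omega)
      (by norm_num) (bound H hH V D hD h)
  · exact (bound H hH V D hD h).trans
      (Nat.pow_le_pow_right (by norm_num) (hk.cliqueNumber_le_of_transitiveTournament hD))
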